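/- For $\gamma>0$, $\ell\ge 0$ and $k\in\mathbb C$ let $$F(k,\ell,\gamma)=F_-(k,\gamma)F_+(k,\gamma)-e^{-4ik\ell}F_0(k,\gamma),$$ $$F_\pm(k,\gamma)=2ik\cos\sqrt{k^2\pm i\gamma}-(2k^2\pm i\gamma)\frac{\sin\sqrt{k^2\pm i\gamma}}{\sqrt{k^2\pm i\gamma}},\qquad F_0(k,\gamma)=\gamma^2\,\frac{\sin\sqrt{k^2-i\gamma}}{\sqrt{k^2-i\gamma}}\,\frac{\sin\sqrt{k^2+i\gamma}}{\sqrt{k^2+i\gamma}},$$ where $\frac{\sin w}{w}$ is understood as $1$ at $w=0$ (the choice of the branch of the square roots is immaterial), and let $$\Theta(\gamma)=\frac{2(1-e^{-\pi/4})\gamma}{17\bigl(1+\sqrt{1-e^{-\pi/4}}\bigr)\sqrt{\gamma}+\frac{10\pi}{\sqrt3}}.$$ Let $\gamma>0$ and $n\in\mathbb Z$. For every $\ell$ with $$\frac{\pi|n|}{2}+\frac{\pi}{4}\le\Theta(\gamma)\,\ell$$ the disc $\{k\in\mathbb C:\ |k-\frac{\pi n}{2\ell}|<\frac{\pi}{4\ell}\}$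 contains exactly one zero $k_n(\ell,\gamma)$ of $F(\cdot,\ell,\gamma)$, and this zero is simple. The zero is holomorphic in $\ell^{-1}$: there is a holomorphic function $\kappa$ on an open set of $\mathbb C$ containing the segment of all real $\varepsilon\ge0$ with $(\frac{\pi|n|}{2}+\frac{\pi}{4})\varepsilon\le\Theta(\gamma)$, such that $k_n(\ell,\gamma)=\kappa(\ell^{-1})$ for all these $\ell$. As $\ell\to+\infty$ (with $n$ and $\gamma$ fixed), the leading terms of its Taylor series are $$k_n(\ell,\gamma)=\frac{\pi n}{2}\,\ell^{-1}-\frac{\sqrt2\,\pi n(\sinh\sqrt{2\gamma}-\sin\sqrt{2\gamma})}{4\sqrt\gamma(\cosh\sqrt{2\gamma}-\cos\sqrt{2\gamma})}\,\ell^{-2}-\frac{2i\pi^2n^2\sinh\sqrt{2\gamma}\,\sin\sqrt{2\gamma}-\pi n(\sinh\sqrt{2\gamma}-\sin\sqrt{2\gamma})^2}{4\gamma(\cosh\sqrt{2\gamma}-\cos\sqrt{2\gamma})^2}\,\ell^{-3}+O(\ell^{-4}).$$ In particular, for each fixed $n\neq0$ and all sufficiently large $\ell$, the zero $k_n(\ell,\gamma)$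 lies in the open upper half-plane (a resonance) if $\sin\sqrt{2\gamma}<0$, and in the open lower half-plane (an eigenvalue) if $\sin\sqrt{2\gamma}>0$. -/

import Mathlib

open scoped Asymptotics

/-- The entire function `w ↦ sin w / w`, with value `1` at `w = 0`. -/
noncomputable def sinOver (w : ℂ) : ℂ :=
  if w = 0 then 1 else Complex.sin w / w

/-- A square root of a complex number (principal branch). It is only used inside the even
functions `cos` and `sin w / w`, so the choice of the branch is immaterial. -/
noncomputable def csqrt (z : ℂ) : ℂ :=
  z ^ (1 / 2 : ℂ)

/-- `F₊(k, γ) = 2ik cos √(k² + iγ) - (2k² + iγ) sin √(k² + iγ) / √(k² + iγ)`. -/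
noncomputable def Fplus (k : ℂ) (γ : ℝ) : ℂ :=
  2 * Complex.I * k * Complex.cos (csqrt (k ^ 2 + Complex.I * γ))
    - (2 * k ^ 2 + Complex.I * γ) * sinOver (csqrt (k ^ 2 + Complex.I * γ))

/-- `F₋(k, γ) = 2ik cos √(k² - iγ) - (2k² - iγ) sin √(k² - iγ) / √(k² - iγ)`. -/
noncomputable def Fminus (k : ℂ) (γ : ℝ) : ℂ :=
  2 * Complex.I * k * Complex.cos (csqrt (k ^ 2 - Complex.I * γ))
    - (2 * k ^ 2 - Complex.I * γ) * sinOver (csqrt (k ^ 2 - Complex.I * γ))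

/-- `F₀(k, γ) = γ² (sin √(k² - iγ) / √(k² - iγ)) (sin √(k² + iγ) / √(k² + iγ))`. -/
noncomputable def Fzero (k : ℂ) (γ : ℝ) : ℂ :=
  (γ : ℂ) ^ 2 * sinOver (csqrt (k ^ 2 - Complex.I * γ))
    * sinOver (csqrt (k ^ 2 + Complex.I * γ))

/-- `F(k, ℓ, γ) = F₋(k, γ) F₊(k, γ) - exp(-4ikℓ) F₀(k, γ)`, whose zeros `k` are the resonances
and eigenvalues of the waveguide with gain-and-loss amplitude `γ` and half-distance `ℓ`. -/
noncomputable def waveF (k : ℂ) (ℓ γ : ℝ) : ℂ :=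
  Fminus k γ * Fplus k γ - Complex.exp (-4 * Complex.I * k * ℓ) * Fzero k γ

/-- The threshold `Θ(γ)`. -/
noncomputable def Theta (γ : ℝ) : ℝ :=
  2 * (1 - Real.exp (-(Real.pi / 4))) * γ
    / (17 * (1 + √(1 - Real.exp (-(Real.pi / 4)))) * √γ + 10 * Real.pi / √3)

/-- The condition `π|n|/2 + π/4 ≤ Θ(γ) ℓ` on the number `n` and the half-distance `ℓ`. -/
def Admissible (γ : ℝ) (n : ℤ) (ℓ : ℝ) : Prop :=
  Real.pi * |(n : ℝ)| / 2 + Real.pi / 4 ≤ Theta γ * ℓ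

/-- The disc `|k - πn/(2ℓ)| < π/(4ℓ)`. -/
def zeroDisc (n : ℤ) (ℓ : ℝ) : Set ℂ :=
  Metric.ball ((Real.pi * n / (2 * ℓ) : ℝ) : ℂ) (Real.pi / (4 * ℓ))

/-- Coefficient of `ℓ⁻¹` in the expansion of the `n`-th zero. -/
noncomputable def coeffOne (n : ℤ) : ℝ :=
  Real.pi * n / 2

/-- Coefficient of `ℓ⁻²` in the expansion of the `n`-th zero. -/
noncomputable def coeffTwo (γ : ℝ) (n : ℤ) : ℝ :=
  -(√2 * Real.pi * n * (Real.sinh √(2 * γ) - Real.sin √(2 * γ))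
    / (4 * √γ * (Real.cosh √(2 * γ) - Real.cos √(2 * γ))))

/-- Coefficient of `ℓ⁻³` in the expansion of the `n`-th zero. -/
noncomputable def coeffThree (γ : ℝ) (n : ℤ) : ℂ :=
  -((2 * Complex.I * (Real.pi ^ 2 * n ^ 2 * Real.sinh √(2 * γ) * Real.sin √(2 * γ) : ℝ)
      - (Real.pi * n * (Real.sinh √(2 * γ) - Real.sin √(2 * γ)) ^ 2 : ℝ))
    / (4 * γ * (Real.cosh √(2 * γ) - Real.cos √(2 * γ)) ^ 2 : ℝ))

/-! Near k = 0 each factor F_± is ∓iγ sin w / w, with w = √(k² ± iγ), times a number close to 1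
(`ratio`). Hence F = F_0 · (exp(-4ih) - exp(-4ikℓ)) with F_0 ≠ 0 and h = `phaseShift γ` holomorphic,
and the zeros are the solutions of kℓ = πm/2 + h(k), m an integer (`waveF_eq_zero_iff`).

On |k| ≤ 2Θ one has |h| ≤ 3/8 < π/4, so a zero in the n-th disc must have m = n. By Cauchy's
estimate h has Lipschitz constant 1/(2Θ) on |k| ≤ 9Θ/8, so for ε = 1/ℓ the map k ↦ ε(πn/2 + h(k)) is
a contraction. Its fixed point is the zero; it is simple because ℓ > |h'|, and it is holomorphic in
ε as a uniform limit of holomorphic iterates (`exists_differentiableOn_fixedPoint`).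

If h(k) = ak + bk² + O(k³) and N = πn/2, the equation yields k = Nε + Naε² + (Na² + bN²)ε³ + O(ε⁴)
(`isBigO_fixedPoint`). Here a is real and b is imaginary, Im b having the sign of -sin √(2γ), so bN²
decides the half-plane. -/

/-! ### Square roots and bounds for complex sine and cosine -/

theorem csqrt_sq (z : ℂ) : csqrt z ^ 2 = z := by
  have := Complex.cpow_nat_inv_pow z (n := 2) (by norm_num)
  simpa only [csqrt, one_div, Nat.cast_ofNat] using this

theorem differentiableAt_csqrt {z : ℂ} (hz : z ∈ Complex.slitPlane) :
    DifferentiableAt ℂ csqrt z :=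
  (Complex.hasStrictDerivAt_cpow_const hz).hasDerivAt.differentiableAt

theorem csqrt_ne_zero {z : ℂ} (hz : z ≠ 0) : csqrt z ≠ 0 := by
  intro h
  apply hz
  rw [← csqrt_sq z, h]; simp

/-- Of the two identities cos w = exp(±iw) ∓ i sin w, one has an exponential of modulus at most 1,
depending on the sign of Im w. -/
theorem norm_cos_le_one_add_norm_sin (w : ℂ) : ‖Complex.cos w‖ ≤ 1 + ‖Complex.sin w‖ := by
  rcases le_total 0 w.im with h | h
  · have e : Complex.cos w = Complex.exp (w * Complex.I) - Complex.sin w * Complex.I := by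
      rw [Complex.exp_mul_I]; ring
    have h1 : ‖Complex.exp (w * Complex.I)‖ ≤ 1 := by
      rw [Complex.norm_exp]; simpa using h
    calc ‖Complex.cos w‖ ≤ ‖Complex.exp (w * Complex.I)‖ + ‖Complex.sin w * Complex.I‖ := by
          rw [e]; exact norm_sub_le _ _
      _ ≤ 1 + ‖Complex.sin w‖ := by
          rw [norm_mul, Complex.norm_I, mul_one]; linarith
  · have e : Complex.cos w = Complex.exp (-w * Complex.I) + Complex.sin w * Complex.I := by
      rw [Complex.exp_mul_I, Complex.cos_neg, Complex.sin_neg]; ring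
    have h1 : ‖Complex.exp (-w * Complex.I)‖ ≤ 1 := by
      rw [Complex.norm_exp]; simpa using h
    calc ‖Complex.cos w‖ ≤ ‖Complex.exp (-w * Complex.I)‖ + ‖Complex.sin w * Complex.I‖ := by
          rw [e]; exact norm_add_le _ _
      _ ≤ 1 + ‖Complex.sin w‖ := by
          rw [norm_mul, Complex.norm_I, mul_one]; linarith

/-- For w = x + iy, |sin w|² = sin² x + sinh² y, and sinh² y ≥ y². -/
theorem abs_im_le_norm_sin (w : ℂ) : |w.im| ≤ ‖Complex.sin w‖ := by
  apply abs_le_of_sq_le_sq _ (norm_nonneg _)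
  rw [Complex.sq_norm, Complex.normSq_apply]
  have e := Complex.sin_eq w
  have hre : (Complex.sin w).re = Real.sin w.re * Real.cosh w.im := by
    rw [e]
    simp [← Complex.ofReal_sin, ← Complex.ofReal_cosh, ← Complex.ofReal_cos, ← Complex.ofReal_sinh]
  have him : (Complex.sin w).im = Real.cos w.re * Real.sinh w.im := by
    rw [e]
    simp [← Complex.ofReal_sin, ← Complex.ofReal_cosh, ← Complex.ofReal_cos, ← Complex.ofReal_sinh]
  have hs : w.im ^ 2 ≤ Real.sinh w.im ^ 2 := by
    apply sq_le_sq.2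
    rcases le_total 0 w.im with h | h
    · rw [abs_of_nonneg h, abs_of_nonneg (Real.sinh_nonneg_iff.2 h)]
      exact Real.self_le_sinh_iff.2 h
    · rw [abs_of_nonpos h, abs_of_nonpos (Real.sinh_nonpos_iff.2 h)]
      exact neg_le_neg (Real.sinh_le_self_iff.2 h)
  rw [hre, him]
  have hc := Real.cosh_sq w.im
  have ht := Real.sin_sq_add_cos_sq w.re
  have : Real.sin w.re * Real.cosh w.im * (Real.sin w.re * Real.cosh w.im)
      + Real.cos w.re * Real.sinh w.im * (Real.cos w.re * Real.sinh w.im)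
      = Real.sinh w.im ^ 2 + Real.sin w.re ^ 2 := by
    linear_combination Real.sin w.re ^ 2 * hc + Real.sinh w.im ^ 2 * ht
  rw [this]
  nlinarith [sq_nonneg (Real.sin w.re)]

/-- The function `z ↦ √z cot √z`. -/
noncomputable def sqrtCot (z : ℂ) : ℂ :=
  csqrt z * Complex.cos (csqrt z) / Complex.sin (csqrt z)

/-- The quotient `F_±(k, γ) / (∓ iγ sin √(k² ± iγ) / √(k² ± iγ))`, where `s = ± γ`. -/
noncomputable def ratio (s : ℝ) (k : ℂ) : ℂ :=
  1 + (-(2 * Complex.I * k ^ 2 / s) - 2 * k / s * sqrtCot (k ^ 2 + Complex.I * s))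

/-! ### The factors F_± near the origin -/

section
variable {s : ℝ} {k : ℂ}

/-- Since |k²| < |s|, the imaginary part cannot vanish; the principal root is thus holomorphic where
it is used. -/
theorem sq_add_mem_slitPlane (hs : s ≠ 0) (hk : 100 * ‖k‖ ^ 2 ≤ |s|) :
    k ^ 2 + Complex.I * s ∈ Complex.slitPlane := by
  right
  intro h
  have h1 : (k ^ 2).im + s = 0 := by simpa using h
  have h2 := Complex.abs_im_le_norm (k ^ 2)
  rw [norm_pow] at h2
  have h3 : (k ^ 2).im = -s := by linarith
  rw [h3, abs_neg] at h2
  have := abs_pos.2 hs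
  linarith

/-- The square w² is within |s|/100 of is, so w is nearly on a diagonal: |w|² = (Re² - Im²) + 2 Im²
≤ |s|/100 + 2 Im², and |s| ≤ (100/99)|w|². -/
theorem norm_csqrt_bounds (hs : s ≠ 0) (hk : 100 * ‖k‖ ^ 2 ≤ |s|) :
    ‖csqrt (k ^ 2 + Complex.I * s)‖ ≤ 101 / 100 * √|s| ∧
    ‖csqrt (k ^ 2 + Complex.I * s)‖ ≤ 3 / 2 * |(csqrt (k ^ 2 + Complex.I * s)).im| := by
  set w := csqrt (k ^ 2 + Complex.I * s) with hw
  have hs' := abs_pos.2 hs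
  have hsq : w ^ 2 = k ^ 2 + Complex.I * s := csqrt_sq _
  have hn : ‖w‖ ^ 2 = ‖k ^ 2 + Complex.I * s‖ := by rw [← hsq, norm_pow]
  have hsn : ‖Complex.I * (s : ℂ)‖ = |s| := by simp
  have hup : ‖w‖ ^ 2 ≤ 101 / 100 * |s| := by
    rw [hn]
    have := norm_add_le (k ^ 2) (Complex.I * s)
    rw [hsn, norm_pow] at this
    linarith
  have hlo : 99 / 100 * |s| ≤ ‖w‖ ^ 2 := by
    rw [hn]
    have := norm_sub_le (k ^ 2 + Complex.I * s) (k ^ 2)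
    rw [add_sub_cancel_left, hsn, norm_pow] at this
    linarith
  have hre : w.re ^ 2 - w.im ^ 2 ≤ |s| / 100 := by
    have h1 : (w ^ 2).re = w.re ^ 2 - w.im ^ 2 := by simp [pow_two]
    have h2 : (w ^ 2).re = (k ^ 2).re := by rw [hsq]; simp
    have h3 := Complex.re_le_norm (k ^ 2)
    rw [norm_pow] at h3
    linarith
  have hnn : ‖w‖ ^ 2 = w.re ^ 2 + w.im ^ 2 := by
    rw [Complex.sq_norm, Complex.normSq_apply]; ring
  constructor
  · apply le_of_sq_le_sq _ (by positivity)
    rw [mul_pow, Real.sq_sqrt hs'.le]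
    linarith
  · apply le_of_sq_le_sq _ (by positivity)
    rw [mul_pow, sq_abs]
    nlinarith

theorem sin_csqrt_ne_zero (hs : s ≠ 0) (hk : 100 * ‖k‖ ^ 2 ≤ |s|) :
    Complex.sin (csqrt (k ^ 2 + Complex.I * s)) ≠ 0 := by
  intro h
  have h1 := abs_im_le_norm_sin (csqrt (k ^ 2 + Complex.I * s))
  have h2 := (norm_csqrt_bounds hs hk).2
  rw [h, norm_zero] at h1
  have h3 : 0 < ‖csqrt (k ^ 2 + Complex.I * s)‖ :=
    norm_pos_iff.2 (csqrt_ne_zero (Complex.slitPlane_ne_zero (sq_add_mem_slitPlane hs hk)))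
  linarith

/-- |w cot w| ≤ |w|/|sin w| + |w|, where |sin w| ≥ |Im w| ≥ (2/3)|w|. -/
theorem norm_sqrtCot_le (hs : s ≠ 0) (hk : 100 * ‖k‖ ^ 2 ≤ |s|) :
    ‖sqrtCot (k ^ 2 + Complex.I * s)‖ ≤ 101 / 100 * √|s| + 3 / 2 := by
  obtain ⟨h1, h2⟩ := norm_csqrt_bounds hs hk
  have h3 := norm_pos_iff.2 (sin_csqrt_ne_zero hs hk)
  rw [sqrtCot, norm_div, norm_mul, div_le_iff₀ h3]
  set w := csqrt (k ^ 2 + Complex.I * s)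
  have h4 := norm_cos_le_one_add_norm_sin w
  have h5 := abs_im_le_norm_sin w
  calc ‖w‖ * ‖Complex.cos w‖ ≤ ‖w‖ * (1 + ‖Complex.sin w‖) := by gcongr
    _ = ‖w‖ + ‖w‖ * ‖Complex.sin w‖ := by ring
    _ ≤ 3 / 2 * ‖Complex.sin w‖ + 101 / 100 * √|s| * ‖Complex.sin w‖ := by gcongr; linarith
    _ = _ := by ring

theorem sinOver_csqrt (hs : s ≠ 0) (hk : 100 * ‖k‖ ^ 2 ≤ |s|) :
    sinOver (csqrt (k ^ 2 + Complex.I * s)) =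
      Complex.sin (csqrt (k ^ 2 + Complex.I * s)) / csqrt (k ^ 2 + Complex.I * s) :=
  if_neg (csqrt_ne_zero (Complex.slitPlane_ne_zero (sq_add_mem_slitPlane hs hk)))

theorem sinOver_csqrt_ne_zero (hs : s ≠ 0) (hk : 100 * ‖k‖ ^ 2 ≤ |s|) :
    sinOver (csqrt (k ^ 2 + Complex.I * s)) ≠ 0 := by
  rw [sinOver_csqrt hs hk]
  exact div_ne_zero (sin_csqrt_ne_zero hs hk)
    (csqrt_ne_zero (Complex.slitPlane_ne_zero (sq_add_mem_slitPlane hs hk)))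

theorem factor_eq_ratio (hs : s ≠ 0) (hk : 100 * ‖k‖ ^ 2 ≤ |s|) :
    2 * Complex.I * k * Complex.cos (csqrt (k ^ 2 + Complex.I * s))
      - (2 * k ^ 2 + Complex.I * s) * sinOver (csqrt (k ^ 2 + Complex.I * s))
    = -Complex.I * s * sinOver (csqrt (k ^ 2 + Complex.I * s)) * ratio s k := by
  rw [sinOver_csqrt hs hk, ratio, sqrtCot]
  have h1 := sin_csqrt_ne_zero hs hk
  have h2 := csqrt_ne_zero (Complex.slitPlane_ne_zero (sq_add_mem_slitPlane hs hk))
  have h3 : (s : ℂ) ≠ 0 := by exact_mod_cast hs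
  set w := csqrt (k ^ 2 + Complex.I * s)
  field_simp
  linear_combination (-2 * k ^ 2 * Complex.sin w) * Complex.I_sq

theorem differentiableAt_sqrtCot {z : ℂ} (hz : z ∈ Complex.slitPlane)
    (h : Complex.sin (csqrt z) ≠ 0) : DifferentiableAt ℂ sqrtCot z := by
  have := differentiableAt_csqrt hz
  unfold sqrtCot
  fun_prop (disch := assumption)

theorem differentiableAt_ratio (hs : s ≠ 0) (hk : 100 * ‖k‖ ^ 2 ≤ |s|) :
    DifferentiableAt ℂ (ratio s) k := by
  have h1 := differentiableAt_sqrtCot (sq_add_mem_slitPlane hs hk) (sin_csqrt_ne_zero hs hk)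
  have h2 : DifferentiableAt ℂ (fun k : ℂ => sqrtCot (k ^ 2 + Complex.I * s)) k :=
    DifferentiableAt.comp k (f := fun k : ℂ => k ^ 2 + Complex.I * s) h1 (by fun_prop)
  unfold ratio
  fun_prop

theorem differentiableAt_sinOver (hs : s ≠ 0) (hk : 100 * ‖k‖ ^ 2 ≤ |s|) :
    DifferentiableAt ℂ (fun k : ℂ => sinOver (csqrt (k ^ 2 + Complex.I * s))) k := by
  have hz := sq_add_mem_slitPlane hs hk
  have h1 : DifferentiableAt ℂ (fun k : ℂ => csqrt (k ^ 2 + Complex.I * s)) k :=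
    DifferentiableAt.comp k (f := fun k : ℂ => k ^ 2 + Complex.I * s)
      (differentiableAt_csqrt hz) (by fun_prop)
  have hne := csqrt_ne_zero (Complex.slitPlane_ne_zero hz)
  have h2 : DifferentiableAt ℂ (fun k : ℂ => Complex.sin (csqrt (k ^ 2 + Complex.I * s))
      / csqrt (k ^ 2 + Complex.I * s)) k := by
    fun_prop (disch := assumption)
  refine h2.congr_of_eventuallyEq ?_
  filter_upwards [h1.continuousAt.eventually_ne hne] with x hx
  exact if_neg hx

end

/-! ### The threshold Θ(γ) -/

theorem Theta_pos {γ : ℝ} (hγ : 0 < γ) : 0 < Theta γ := by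
  have h : Real.exp (-(Real.pi / 4)) < 1 := by simp [Real.pi_pos]
  have h' : 0 < 1 - Real.exp (-(Real.pi / 4)) := by linarith
  unfold Theta
  have := Real.pi_pos
  positivity

/-- Together with positivity, this is all that is needed of Θ. It gives 529 Θ² ≤ γ and controls the
cotangent term of `ratio`. -/
theorem Theta_mul_le {γ : ℝ} (hγ : 0 < γ) : Theta γ * (23 * √γ + 14) ≤ γ := by
  have h : Real.exp (-(Real.pi / 4)) < 1 := by simp [Real.pi_pos]
  have hlow : 0.36 ≤ Real.exp (-(Real.pi / 4)) := by
    have h1 : Real.exp (-1) ≤ Real.exp (-(Real.pi / 4)) :=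
      Real.exp_le_exp.2 (by linarith [Real.pi_lt_four])
    have h2 := Real.exp_neg_one_gt_d9
    linarith
  unfold Theta
  set c := 1 - Real.exp (-(Real.pi / 4)) with hc
  have hc0 : 0 ≤ c := by linarith
  have hpi := Real.pi_pos
  set t := √c
  have ht0 : 0 ≤ t := Real.sqrt_nonneg _
  have htc : t ^ 2 = c := Real.sq_sqrt hc0
  have ht : t ≤ 0.8 := Real.sqrt_le_iff.2 ⟨by norm_num, by norm_num; linarith⟩
  have h3 : 17.92 ≤ 10 * Real.pi / √3 := by
    have h3p : (0 : ℝ) < √3 := by positivity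
    have : √3 ≤ 1.7321 := Real.sqrt_le_iff.2 ⟨by norm_num, by norm_num⟩
    rw [le_div_iff₀ h3p]
    linarith [Real.pi_gt_d2]
  have hg : 0 ≤ √γ := Real.sqrt_nonneg _
  have hden : 0 < 17 * (1 + t) * √γ + 10 * Real.pi / √3 := by positivity
  rw [div_mul_eq_mul_div, div_le_iff₀ hden]
  -- 46 = 2 · 23 and 28 = 2 · 14, the factor 2 coming from the numerator of Θ. Both bounds rest on c
  -- ≤ 0.64 = 0.8².
  have h4 : 46 * c ≤ 17 * (1 + t) := by rw [← htc]; nlinarith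
  have h5 : 28 * c ≤ 10 * Real.pi / √3 := by linarith
  have h6 := mul_le_mul_of_nonneg_right h4 hg
  nlinarith

theorem norm_ratio_sub_one_le {γ s : ℝ} {k : ℂ} (hγ : 0 < γ) (hs : |s| = γ)
    (hk : ‖k‖ ≤ 2 * Theta γ) :
    100 * ‖k‖ ^ 2 ≤ |s| ∧
    ‖-(2 * Complex.I * k ^ 2 / s) - 2 * k / s * sqrtCot (k ^ 2 + Complex.I * s)‖ ≤ 1 / 2 := by
  have hT := Theta_pos hγ
  have hT2 := Theta_mul_le hγ
  set T := Theta γ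
  set q := √γ with hq
  have hq0 : 0 < q := Real.sqrt_pos.2 hγ
  have hqq : q ^ 2 = γ := Real.sq_sqrt hγ.le
  have hTq : 23 * T ≤ q := by
    have : q * (23 * T) ≤ q * q := by nlinarith
    exact le_of_mul_le_mul_left this hq0
  have hTT : 529 * T ^ 2 ≤ γ := by nlinarith
  have hk2 : ‖k‖ ^ 2 ≤ 4 * T ^ 2 := by nlinarith [norm_nonneg k]
  have h100 : 100 * ‖k‖ ^ 2 ≤ |s| := by rw [hs]; nlinarith
  have hs0 : s ≠ 0 := by rintro rfl; simp at hs; linarith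
  refine ⟨h100, ?_⟩
  have hC := norm_sqrtCot_le hs0 h100
  rw [hs, ← hq] at hC
  refine (norm_sub_le _ _).trans ?_
  have e1 : ‖-(2 * Complex.I * k ^ 2 / (s : ℂ))‖ = 2 * ‖k‖ ^ 2 / γ := by
    simp [hs]
  have e2 : ‖2 * k / (s : ℂ) * sqrtCot (k ^ 2 + Complex.I * s)‖
      = 2 * ‖k‖ / γ * ‖sqrtCot (k ^ 2 + Complex.I * s)‖ := by
    simp [hs]
  rw [e1, e2]
  have b1 : 2 * ‖k‖ ^ 2 / γ ≤ 8 / 529 := by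
    rw [div_le_iff₀ hγ]; linarith
  -- The constant 14 enters here: 4 · 3/2 = (3/7) · 14. Moreover 8/529 + 3/7 < 1/2.
  have b2 : 2 * ‖k‖ / γ * ‖sqrtCot (k ^ 2 + Complex.I * s)‖ ≤ 3 / 7 := by
    calc 2 * ‖k‖ / γ * ‖sqrtCot (k ^ 2 + Complex.I * s)‖
        ≤ 2 * (2 * T) / γ * (101 / 100 * q + 3 / 2) := by gcongr
      _ ≤ 3 / 7 := by
          rw [div_mul_eq_mul_div, div_le_iff₀ hγ]; nlinarith [mul_pos hT hq0]
  linarith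

/-! ### Holomorphic dependence of fixed points on the parameter -/

/-- The iterates of z ↦ ε φ(z) from 0 are holomorphic in ε and converge geometrically at a rate
independent of ε, so their limit is holomorphic. -/
theorem exists_differentiableOn_fixedPoint {φ : ℂ → ℂ} {r q L : ℝ} {U : Set ℂ} (hU : IsOpen U)
    (hr : 0 ≤ r) (hq : q < 1) (hq0 : 0 ≤ q)
    (hd : ∀ z : ℂ, ‖z‖ ≤ r → DifferentiableAt ℂ φ z)
    (hL : ∀ x y : ℂ, ‖x‖ ≤ r → ‖y‖ ≤ r → ‖φ x - φ y‖ ≤ L * ‖x - y‖)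
    (hmaps : ∀ ε ∈ U, ∀ z : ℂ, ‖z‖ ≤ r → ‖ε * φ z‖ ≤ r)
    (hcontr : ∀ ε ∈ U, ‖ε‖ * L ≤ q) :
    ∃ κ : ℂ → ℂ, DifferentiableOn ℂ κ U ∧ ∀ ε ∈ U, ‖κ ε‖ ≤ r ∧ κ ε = ε * φ (κ ε) := by
  set f : ℕ → ℂ → ℂ := fun m => Nat.rec (fun _ => 0) (fun _ g ε => ε * φ (g ε)) m with hf
  have f0 : ∀ ε, f 0 ε = 0 := fun _ => rfl
  have fs : ∀ m ε, f (m + 1) ε = ε * φ (f m ε) := fun _ _ => rfl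
  have hb : ∀ m, ∀ ε ∈ U, ‖f m ε‖ ≤ r := by
    intro m
    induction m with
    | zero => intro ε _; rw [f0]; simpa using hr
    | succ m ih => intro ε hε; rw [fs]; exact hmaps ε hε _ (ih ε hε)
  have hfd : ∀ m, DifferentiableOn ℂ (f m) U := by
    intro m
    induction m with
    | zero => exact differentiableOn_const (c := (0 : ℂ))
    | succ m ih =>
      refine differentiableOn_id.mul fun ε hε => ?_
      exact DifferentiableAt.comp_differentiableWithinAt ε (hd _ (hb m ε hε)) (ih ε hε)
  have hstep : ∀ ε ∈ U, ∀ m, dist (f m ε) (f (m + 1) ε) ≤ r * q ^ m := by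
    intro ε hε m
    induction m with
    | zero => rw [f0, dist_zero_left]; simpa using hb 1 ε hε
    | succ m ih =>
      rw [fs (m + 1), fs m, dist_eq_norm, ← mul_sub, norm_mul]
      rw [dist_eq_norm] at ih
      calc ‖ε‖ * ‖φ (f m ε) - φ (f (m + 1) ε)‖
          ≤ ‖ε‖ * (L * ‖f m ε - f (m + 1) ε‖) := by
            gcongr; exact hL _ _ (hb m ε hε) (hb (m + 1) ε hε)
        _ = ‖ε‖ * L * ‖f m ε - f (m + 1) ε‖ := by ring
        _ ≤ q * (r * q ^ m) := mul_le_mul (hcontr ε hε) ih (norm_nonneg _) hq0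
        _ = r * q ^ (m + 1) := by ring
  have hlim : ∀ ε, ∃ a, ε ∈ U → Filter.Tendsto (fun m => f m ε) Filter.atTop (nhds a) := by
    intro ε
    by_cases hε : ε ∈ U
    · obtain ⟨a, ha⟩ := cauchySeq_tendsto_of_complete
        (cauchySeq_of_le_geometric q r hq (hstep ε hε))
      exact ⟨a, fun _ => ha⟩
    · exact ⟨0, fun h => absurd h hε⟩
  choose κ hκ using hlim
  have hunif : TendstoUniformlyOn f κ Filter.atTop U := by
    rw [Metric.tendstoUniformlyOn_iff]
    intro δ hδ
    have ht : Filter.Tendsto (fun m : ℕ => r * q ^ m / (1 - q)) Filter.atTop (nhds 0) := by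
      simpa using ((tendsto_pow_atTop_nhds_zero_of_lt_one hq0 hq).const_mul r).div_const (1 - q)
    filter_upwards [ht.eventually_lt_const hδ] with m hm ε hε
    rw [dist_comm]
    exact (dist_le_of_le_geometric_of_tendsto q r hq (hstep ε hε) (hκ ε hε) m).trans_lt hm
  have hκb : ∀ ε ∈ U, ‖κ ε‖ ≤ r := fun ε hε =>
    le_of_tendsto (hκ ε hε).norm (Filter.Eventually.of_forall fun m => hb m ε hε)
  refine ⟨κ, hunif.tendstoLocallyUniformlyOn.differentiableOn
    (Filter.Eventually.of_forall hfd) hU, fun ε hε => ⟨hκb ε hε, ?_⟩⟩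
  have h1 := (hκ ε hε).comp (Filter.tendsto_add_atTop_nat 1)
  have h2 : Filter.Tendsto (fun m => ε * φ (f m ε)) Filter.atTop (nhds (ε * φ (κ ε))) :=
    ((hd _ (hκb ε hε)).continuousAt.tendsto.comp (hκ ε hε)).const_mul ε
  exact tendsto_nhds_unique h1 h2

/-- The function `h` with `exp (-4ih) = F₋ F₊ / F₀` near the origin. -/
noncomputable def phaseShift (γ : ℝ) (k : ℂ) : ℂ :=
  Complex.I / 4 * (Complex.log (ratio γ k) + Complex.log (ratio (-γ) k))

/-! ### The phase shift and the factorisation of F -/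

section
variable {γ : ℝ} {k : ℂ}

theorem norm_log_ratio_le {s : ℝ} (hγ : 0 < γ) (hs : |s| = γ) (hk : ‖k‖ ≤ 2 * Theta γ) :
    ‖Complex.log (ratio s k)‖ ≤ 3 / 4 := by
  have h := (norm_ratio_sub_one_le hγ hs hk).2
  have := Complex.norm_log_one_add_half_le_self h
  unfold ratio
  linarith

theorem ratio_mem_slitPlane {s : ℝ} (hγ : 0 < γ) (hs : |s| = γ) (hk : ‖k‖ ≤ 2 * Theta γ) :
    ratio s k ∈ Complex.slitPlane :=
  Complex.mem_slitPlane_of_norm_lt_one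
    ((norm_ratio_sub_one_le hγ hs hk).2.trans_lt (by norm_num))

theorem norm_phaseShift_le (hγ : 0 < γ) (hk : ‖k‖ ≤ 2 * Theta γ) : ‖phaseShift γ k‖ ≤ 3 / 8 := by
  have h1 := norm_log_ratio_le hγ (abs_of_pos hγ) hk
  have h2 := norm_log_ratio_le hγ (by rw [abs_neg]; exact abs_of_pos hγ : |-γ| = γ) hk
  have h3 := norm_add_le (Complex.log (ratio γ k)) (Complex.log (ratio (-γ) k))
  have e : ‖Complex.I / 4‖ = 1 / 4 := by simp
  rw [phaseShift, norm_mul, e]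
  linarith

theorem differentiableAt_phaseShift (hγ : 0 < γ) (hk : ‖k‖ ≤ 2 * Theta γ) :
    DifferentiableAt ℂ (phaseShift γ) k := by
  have a1 := abs_of_pos hγ
  have a2 : |-γ| = γ := by rw [abs_neg]; exact a1
  have h1 := differentiableAt_ratio hγ.ne' (norm_ratio_sub_one_le hγ a1 hk).1
  have h2 := differentiableAt_ratio (neg_ne_zero.2 hγ.ne') (norm_ratio_sub_one_le hγ a2 hk).1
  exact ((h1.clog (ratio_mem_slitPlane hγ a1 hk)).add
    (h2.clog (ratio_mem_slitPlane hγ a2 hk))).const_mul _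

theorem norm_deriv_phaseShift_le (hγ : 0 < γ) (hk : ‖k‖ ≤ 9 / 8 * Theta γ) :
    ‖deriv (phaseShift γ) k‖ ≤ 1 / (2 * Theta γ) := by
  have hT := Theta_pos hγ
  -- Cauchy's estimate on radius 3Θ/4: 9/8 + 3/4 < 2 keeps the disc where |h| ≤ 3/8, and
  -- (3/8)/(3Θ/4) = 1/(2Θ).
  have hball : ∀ z ∈ Metric.closedBall k (3 / 4 * Theta γ), ‖z‖ ≤ 2 * Theta γ := by
    intro z hz
    have h1 : ‖z - k‖ ≤ 3 / 4 * Theta γ := by simpa [dist_eq_norm] using hz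
    have h2 := norm_add_le (z - k) k
    rw [sub_add_cancel] at h2
    linarith
  have hd : DifferentiableOn ℂ (phaseShift γ) (Metric.closedBall k (3 / 4 * Theta γ)) :=
    fun z hz => (differentiableAt_phaseShift hγ (hball z hz)).differentiableWithinAt
  have := Complex.norm_deriv_le_of_forall_mem_sphere_norm_le (by positivity)
    (hd.diffContOnCl_ball subset_rfl)
    (fun z hz => norm_phaseShift_le hγ (hball z (Metric.sphere_subset_closedBall hz)))
  refine this.trans_eq ?_
  field_simp
  norm_num

theorem norm_phaseShift_sub_le (hγ : 0 < γ) {x y : ℂ} (hx : ‖x‖ ≤ 9 / 8 * Theta γ)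
    (hy : ‖y‖ ≤ 9 / 8 * Theta γ) :
    ‖phaseShift γ x - phaseShift γ y‖ ≤ 1 / (2 * Theta γ) * ‖x - y‖ := by
  have hT := Theta_pos hγ
  refine Convex.norm_image_sub_le_of_norm_deriv_le (s := Metric.closedBall 0 (9 / 8 * Theta γ))
    (fun z hz => differentiableAt_phaseShift hγ ?_)
    (fun z hz => norm_deriv_phaseShift_le hγ ?_) (convex_closedBall _ _) ?_ ?_
  · have : ‖z‖ ≤ 9 / 8 * Theta γ := by simpa using hz
    linarith
  · simpa using hz
  · simpa using hy
  · simpa using hx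

theorem sub_eq_add_neg_cast (k : ℂ) (γ : ℝ) :
    k ^ 2 - Complex.I * γ = k ^ 2 + Complex.I * ((-γ : ℝ) : ℂ) := by
  push_cast; ring

theorem Fzero_ne_zero (hγ : 0 < γ) (hk : ‖k‖ ≤ 2 * Theta γ) : Fzero k γ ≠ 0 := by
  have h1 := sinOver_csqrt_ne_zero hγ.ne' (norm_ratio_sub_one_le hγ (abs_of_pos hγ) hk).1
  have h2 := sinOver_csqrt_ne_zero (neg_ne_zero.2 hγ.ne')
    (norm_ratio_sub_one_le hγ (by rw [abs_neg]; exact abs_of_pos hγ) hk).1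
  rw [Fzero, sub_eq_add_neg_cast]
  have : (γ : ℂ) ≠ 0 := by exact_mod_cast hγ.ne'
  positivity

theorem differentiableAt_Fzero (hγ : 0 < γ) (hk : ‖k‖ ≤ 2 * Theta γ) :
    DifferentiableAt ℂ (fun k => Fzero k γ) k := by
  have h1 := differentiableAt_sinOver hγ.ne' (norm_ratio_sub_one_le hγ (abs_of_pos hγ) hk).1
  have h2 := differentiableAt_sinOver (neg_ne_zero.2 hγ.ne')
    (norm_ratio_sub_one_le hγ (by rw [abs_neg]; exact abs_of_pos hγ) hk).1
  unfold Fzero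
  simp only [sub_eq_add_neg_cast]
  exact (h2.const_mul _).mul h1

theorem waveF_eq (hγ : 0 < γ) (hk : ‖k‖ ≤ 2 * Theta γ) (ℓ : ℝ) :
    waveF k ℓ γ = Fzero k γ *
      (Complex.exp (-4 * Complex.I * phaseShift γ k) - Complex.exp (-4 * Complex.I * k * ℓ)) := by
  have a1 := abs_of_pos hγ
  have a2 : |-γ| = γ := by rw [abs_neg]; exact a1
  have e1 := factor_eq_ratio hγ.ne' (norm_ratio_sub_one_le hγ a1 hk).1
  have e2 := factor_eq_ratio (neg_ne_zero.2 hγ.ne') (norm_ratio_sub_one_le hγ a2 hk).1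
  have e3 : -4 * Complex.I * phaseShift γ k =
      Complex.log (ratio γ k) + Complex.log (ratio (-γ) k) := by
    rw [phaseShift]
    linear_combination (-(Complex.log (ratio γ k) + Complex.log (ratio (-γ) k))) * Complex.I_sq
  rw [e3, Complex.exp_add, Complex.exp_log (Complex.slitPlane_ne_zero (ratio_mem_slitPlane hγ a1 hk)),
    Complex.exp_log (Complex.slitPlane_ne_zero (ratio_mem_slitPlane hγ a2 hk))]
  have e4 : 2 * k ^ 2 - Complex.I * γ = 2 * k ^ 2 + Complex.I * ((-γ : ℝ) : ℂ) := by
    push_cast; ring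
  rw [waveF, Fminus, Fplus, Fzero, e4, sub_eq_add_neg_cast, e1, e2]
  push_cast
  linear_combination (-(γ : ℂ) ^ 2 * sinOver (csqrt (k ^ 2 + Complex.I * -(γ : ℂ)))
    * sinOver (csqrt (k ^ 2 + Complex.I * γ)) * ratio γ k * ratio (-γ) k) * Complex.I_sq

theorem waveF_eq_zero_iff (hγ : 0 < γ) (hk : ‖k‖ ≤ 2 * Theta γ) (ℓ : ℝ) :
    waveF k ℓ γ = 0 ↔ ∃ m : ℤ, k * ℓ = Real.pi * m / 2 + phaseShift γ k := by
  rw [waveF_eq hγ hk, mul_eq_zero, or_iff_right (Fzero_ne_zero hγ hk), sub_eq_zero,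
    Complex.exp_eq_exp_iff_exists_int]
  refine exists_congr fun m => ⟨fun h => ?_, fun h => ?_⟩
  · linear_combination (-Complex.I / 4) * h
      + (k * ℓ - phaseShift γ k - Real.pi * m / 2) * Complex.I_sq
  · linear_combination (4 * Complex.I) * h

/-- At a zero the two exponentials agree, so the derivative is a nonzero multiple of ℓ - h'(k), and
|h'(k)| ≤ 1/(2Θ) < ℓ. -/
theorem analyticOrderAt_waveF (hγ : 0 < γ) {ℓ : ℝ} (hk : ‖k‖ ≤ 9 / 8 * Theta γ)
    (hℓ : 1 / (2 * Theta γ) < ℓ) (h0 : waveF k ℓ γ = 0) :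
    analyticOrderAt (fun z : ℂ => waveF z ℓ γ) k = 1 := by
  have hT := Theta_pos hγ
  have hk2 : ‖k‖ < 2 * Theta γ := by linarith
  have hev : ∀ᶠ z : ℂ in nhds k, ‖z‖ < 2 * Theta γ :=
    continuous_norm.continuousAt.eventually_lt continuousAt_const hk2
  set g : ℂ → ℂ := fun z => Complex.exp (-4 * Complex.I * phaseShift γ z)
    - Complex.exp (-4 * Complex.I * z * ℓ) with hg
  have hp : ∀ {z : ℂ}, ‖z‖ < 2 * Theta γ → HasDerivAt g
      (Complex.exp (-4 * Complex.I * phaseShift γ z)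
        * (-4 * Complex.I * deriv (phaseShift γ) z)
      - Complex.exp (-4 * Complex.I * z * ℓ) * (-4 * Complex.I * ℓ)) z := by
    intro z hz
    have h1 := ((differentiableAt_phaseShift hγ hz.le).hasDerivAt.const_mul
      (-4 * Complex.I)).cexp
    have h2 := (((hasDerivAt_id z).const_mul (-4 * Complex.I)).mul_const (ℓ : ℂ)).cexp
    exact (h1.sub h2).congr_deriv (by simp)
  have heq : (fun z : ℂ => waveF z ℓ γ) =ᶠ[nhds k] fun z => Fzero z γ * g z := by
    filter_upwards [hev] with z hz
    exact waveF_eq hγ hz.le ℓ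
  have hgk : g k = 0 := by
    have := waveF_eq hγ hk2.le ℓ
    rw [h0] at this
    exact (mul_eq_zero.1 this.symm).resolve_left (Fzero_ne_zero hγ hk2.le)
  rw [analyticOrderAt_congr heq]
  have han : AnalyticAt ℂ (fun z => Fzero z γ * g z) k := by
    rw [Complex.analyticAt_iff_eventually_differentiableAt]
    filter_upwards [hev] with z hz
    exact (differentiableAt_Fzero hγ hz.le).mul (hp hz).differentiableAt
  refine han.analyticOrderAt_eq_one_of_zero_deriv_ne_zero (by simp [hgk]) ?_
  have hder := (differentiableAt_Fzero hγ hk2.le).hasDerivAt.mul (hp hk2)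
  have hexp : Complex.exp (-4 * Complex.I * phaseShift γ k)
      = Complex.exp (-4 * Complex.I * k * ℓ) := sub_eq_zero.1 hgk
  have hder' : deriv (fun z => Fzero z γ * g z) k =
      Fzero k γ * (Complex.exp (-4 * Complex.I * k * ℓ) *
        (4 * Complex.I * (ℓ - deriv (phaseShift γ) k))) := by
    refine hder.deriv.trans ?_
    rw [hgk, hexp]
    ring
  rw [hder']
  have hne : (ℓ : ℂ) - deriv (phaseShift γ) k ≠ 0 := by
    intro h
    have h1 := norm_deriv_phaseShift_le hγ hk
    rw [← sub_eq_zero.1 h, Complex.norm_real, Real.norm_eq_abs] at h1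
    linarith [le_abs_self ℓ]
  exact mul_ne_zero (Fzero_ne_zero hγ hk2.le) (mul_ne_zero (Complex.exp_ne_zero _)
    (mul_ne_zero (mul_ne_zero (by norm_num) Complex.I_ne_zero) hne))

end

/-! ### Taylor expansion of the phase shift -/

section expansion
open Asymptotics Filter Topology

theorem isBigO_log_one_add {u : ℂ → ℂ} {a b : ℂ}
    (hu : (fun z => u z - (a * z + b * z ^ 2)) =O[𝓝 0] (fun z : ℂ => z ^ 3)) :
    (fun z => Complex.log (1 + u z) - (a * z + (b - a ^ 2 / 2) * z ^ 2))
      =O[𝓝 0] (fun z : ℂ => z ^ 3) := by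
  have hz : Tendsto (fun z : ℂ => z) (𝓝 0) (𝓝 0) := tendsto_id
  have p32 : (fun z : ℂ => z ^ 3) =O[𝓝 0] (fun z : ℂ => z ^ 2) := by
    exact ((isBigO_refl (fun z : ℂ => z ^ 2) (𝓝 0)).mul (hz.isBigO_one ℂ)).congr
      (fun z => by ring) fun z => by ring
  have p21 : (fun z : ℂ => z ^ 2) =O[𝓝 0] (fun z : ℂ => z) := by
    exact ((isBigO_refl (fun z : ℂ => z) (𝓝 0)).mul (hz.isBigO_one ℂ)).congr
      (fun z => by ring) fun z => by ring
  have q1 : (fun z => u z - a * z) =O[𝓝 0] (fun z : ℂ => z ^ 2) := by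
    have := (hu.trans p32).add ((isBigO_refl (fun z : ℂ => z ^ 2) (𝓝 0)).const_mul_left b)
    exact this.congr_left fun z => by ring
  have q0 : u =O[𝓝 0] (fun z : ℂ => z) := by
    have := (q1.trans p21).add ((isBigO_refl (fun z : ℂ => z) (𝓝 0)).const_mul_left a)
    exact this.congr_left fun z => by ring
  have qs : (fun z => u z ^ 2 - a ^ 2 * z ^ 2) =O[𝓝 0] (fun z : ℂ => z ^ 3) := by
    have := q1.mul (q0.add ((isBigO_refl (fun z : ℂ => z) (𝓝 0)).const_mul_left a))
    exact this.congr (fun z => by ring) fun z => by ring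
  have ht : Tendsto u (𝓝 0) (𝓝 0) := q0.trans_tendsto hz
  have hl : (fun z => Complex.log (1 + u z) - (u z - u z ^ 2 / 2)) =O[𝓝 0]
      (fun z : ℂ => z ^ 3) := by
    refine IsBigO.trans ?_ (q0.pow 3)
    refine IsBigO.of_bound 1 ?_
    have hsm : ∀ᶠ z in 𝓝 0, ‖u z‖ < 1 / 2 := by
      have := ht.norm
      rw [norm_zero] at this
      exact this.eventually_lt_const (by norm_num)
    filter_upwards [hsm] with z hz
    have h := Complex.norm_log_sub_logTaylor_le 2 (hz.trans (by norm_num) : ‖u z‖ < 1)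
    -- `logTaylor (2 + 1)` stops at degree 2, so the remainder is cubic.
    have e : Complex.logTaylor (2 + 1) (u z) = u z - u z ^ 2 / 2 := by
      simp [Complex.logTaylor_succ, Complex.logTaylor_zero]
      ring
    rw [e] at h
    have hi : (1 - ‖u z‖)⁻¹ ≤ 2 := by
      rw [inv_le_comm₀ (by linarith) (by norm_num)]; linarith
    have h3 : (0 : ℝ) ≤ ‖u z‖ ^ 3 := by positivity
    refine h.trans ?_
    rw [norm_pow]
    push_cast
    norm_num
    nlinarith [mul_le_mul_of_nonneg_left hi h3]
  have := (hl.add hu).sub (qs.const_mul_left (1 / 2))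
  exact this.congr_left fun z => by ring

/-- The argument of `sqrtCot` moves only by z², and the extra factor z makes the error cubic. -/
theorem isBigO_ratio {s : ℝ} (hs : s ≠ 0) :
    (fun z => (-(2 * Complex.I * z ^ 2 / s) - 2 * z / s * sqrtCot (z ^ 2 + Complex.I * s))
      - (-(2 / s * sqrtCot (Complex.I * s)) * z + -(2 * Complex.I / s) * z ^ 2))
      =O[𝓝 0] (fun z : ℂ => z ^ 3) := by
  have h0 : 100 * ‖(0 : ℂ)‖ ^ 2 ≤ |s| := by simp
  have hd := differentiableAt_sqrtCot (sq_add_mem_slitPlane hs h0) (sin_csqrt_ne_zero hs h0)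
  have e0 : (0 : ℂ) ^ 2 + Complex.I * s = Complex.I * s := by ring
  have hc : Tendsto (fun z : ℂ => z ^ 2 + Complex.I * s) (𝓝 0) (𝓝 ((0 : ℂ) ^ 2 + Complex.I * s)) :=
    Continuous.tendsto (by fun_prop) 0
  have h1 := hd.hasFDerivAt.isBigO_sub.comp_tendsto hc
  have h2 : (fun z : ℂ => sqrtCot (z ^ 2 + Complex.I * s) - sqrtCot (Complex.I * s)) =O[𝓝 0]
      (fun z : ℂ => z ^ 2) := by
    refine h1.congr (fun z => ?_) fun z => ?_ <;> simp [Function.comp]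
  have h3 := ((isBigO_refl (fun z : ℂ => z) (𝓝 0)).mul h2).const_mul_left (-(2 / s : ℂ))
  exact h3.congr (fun z => by ring) fun z => by ring

theorem isBigO_phaseShift {γ : ℝ} (hγ : γ ≠ 0) :
    (fun z => phaseShift γ z -
      (Complex.I / (2 * γ) * (sqrtCot (-(Complex.I * γ)) - sqrtCot (Complex.I * γ)) * z
      + -(Complex.I / (2 * γ ^ 2) * (sqrtCot (Complex.I * γ) ^ 2
          + sqrtCot (-(Complex.I * γ)) ^ 2)) * z ^ 2))
      =O[𝓝 0] (fun z : ℂ => z ^ 3) := by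
  have h1 := isBigO_log_one_add (isBigO_ratio hγ)
  have h2 := isBigO_log_one_add (isBigO_ratio (neg_ne_zero.2 hγ))
  have e : Complex.I * ((-γ : ℝ) : ℂ) = -(Complex.I * γ) := by push_cast; ring
  rw [e] at h2
  have hγ' : (γ : ℂ) ≠ 0 := by exact_mod_cast hγ
  refine ((h1.add h2).const_mul_left (Complex.I / 4)).congr_left fun z => ?_
  rw [phaseShift, ratio, ratio, e]
  push_cast
  field_simp
  ring

/-- w cot w is even, so any square root of z may be used. -/
theorem sqrtCot_sq {z w : ℂ} (h : w ^ 2 = z) :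
    sqrtCot z = w * Complex.cos w / Complex.sin w := by
  rcases sq_eq_sq_iff_eq_or_eq_neg.1 ((csqrt_sq z).trans h.symm) with h | h
  · rw [sqrtCot, h]
  · rw [sqrtCot, h, Complex.cos_neg, Complex.sin_neg, neg_mul, neg_div_neg_eq]

theorem cosh_sub_cos_pos {t : ℝ} (ht : t ≠ 0) : 0 < Real.cosh t - Real.cos t := by
  linarith [Real.one_lt_cosh.2 ht, Real.cos_le_one t]

theorem cos_div_sin (x y : ℝ) (hy : y ≠ 0) :
    Complex.cos (x + y * Complex.I) / Complex.sin (x + y * Complex.I) =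
      ((Real.sin (2 * x) : ℂ) - Real.sinh (2 * y) * Complex.I)
        / ((Real.cosh (2 * y) - Real.cos (2 * x) : ℝ) : ℂ) := by
  have hpos : 0 < Real.cosh (2 * y) - Real.cos (2 * x) := by
    linarith [Real.one_lt_cosh.2 (show 2 * y ≠ 0 by simpa using hy), Real.cos_le_one (2 * x)]
  have hsin : Complex.sin (x + y * Complex.I) ≠ 0 := by
    intro h
    have := abs_im_le_norm_sin (x + y * Complex.I)
    rw [h, norm_zero] at this
    simp at this
    exact hy this
  rw [div_eq_div_iff hsin (by exact_mod_cast hpos.ne')]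
  rw [Complex.sin_add_mul_I, Complex.cos_add_mul_I]
  push_cast
  rw [Complex.cosh_two_mul, Complex.sinh_two_mul, Complex.cos_two_mul, Complex.sin_two_mul]
  have t1 := Complex.sin_sq_add_cos_sq (x : ℂ)
  have t2 := Complex.cosh_sq (y : ℂ)
  set c := Complex.cos (x : ℂ)
  set d := Complex.sin (x : ℂ)
  set C := Complex.cosh (y : ℂ)
  set S := Complex.sinh (y : ℂ)
  linear_combination (c * C - d * S * Complex.I) * (t2 - 2 * t1)
    - 2 * d * S * Complex.I * (t1 - t2) + 2 * S ^ 2 * C * c * Complex.I_sq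

end expansion

/-! ### Expansion of the zero in powers of 1/ℓ -/

section zero_expansion
open Asymptotics Filter Topology

/-- Bootstrapping: each approximation of κ inserted into the right-hand side gains one power of ε,
thanks to the prefactor ε. -/
theorem isBigO_fixedPoint {h κ : ℂ → ℂ} {N a b : ℂ}
    (hh : (fun z => h z - (a * z + b * z ^ 2)) =O[𝓝 0] (fun z : ℂ => z ^ 3))
    (hκ : κ =O[𝓝 0] (fun ε : ℂ => ε)) (hfix : ∀ᶠ ε in 𝓝 (0 : ℂ), κ ε = ε * (N + h (κ ε))) :
    (fun ε => κ ε - (N * ε + N * a * ε ^ 2 + (N * a ^ 2 + b * N ^ 2) * ε ^ 3))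
      =O[𝓝 0] (fun ε : ℂ => ε ^ 4) := by
  have hid : Tendsto (fun ε : ℂ => ε) (𝓝 0) (𝓝 0) := tendsto_id
  have hbase := isBigO_refl (fun ε : ℂ => ε) (𝓝 0)
  have lower : ∀ j : ℕ, (fun ε : ℂ => ε ^ (j + 1)) =O[𝓝 0] (fun ε : ℂ => ε ^ j) := fun j =>
    ((isBigO_refl (fun ε : ℂ => ε ^ j) (𝓝 0)).mul (hid.isBigO_one ℂ)).congr
      (fun z => by ring) fun z => by ring
  have hκ0 : Tendsto κ (𝓝 0) (𝓝 0) := hκ.trans_tendsto hid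
  have r3 : (fun ε => h (κ ε) - (a * κ ε + b * κ ε ^ 2)) =O[𝓝 0] (fun ε : ℂ => ε ^ 3) :=
    (hh.comp_tendsto hκ0).trans (hκ.pow 3)
  have r2 : (fun ε => h (κ ε) - a * κ ε) =O[𝓝 0] (fun ε : ℂ => ε ^ 2) :=
    ((r3.trans (lower 2)).add ((hκ.pow 2).const_mul_left b)).congr_left fun ε => by ring
  have r1 : (fun ε => h (κ ε)) =O[𝓝 0] (fun ε : ℂ => ε) := by
    have := ((r2.trans (lower 1)).congr_right fun ε => pow_one ε).add (hκ.const_mul_left a)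
    exact this.congr_left fun ε => by ring
  have k2 : (fun ε => κ ε - N * ε) =O[𝓝 0] (fun ε : ℂ => ε ^ 2) := by
    refine (hbase.mul r1).congr' ?_ (Eventually.of_forall fun ε => (pow_two ε).symm)
    filter_upwards [hfix] with ε hε
    linear_combination -hε
  have k3 : (fun ε => κ ε - (N * ε + N * a * ε ^ 2)) =O[𝓝 0] (fun ε : ℂ => ε ^ 3) := by
    refine (hbase.mul (r2.add (k2.const_mul_left a))).congr' ?_
      (Eventually.of_forall fun ε => by ring)
    filter_upwards [hfix] with ε hε
    linear_combination -hε
  have ksq : (fun ε => κ ε ^ 2 - N ^ 2 * ε ^ 2) =O[𝓝 0] (fun ε : ℂ => ε ^ 3) :=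
    (k2.mul (hκ.add (hbase.const_mul_left N))).congr (fun ε => by ring) fun ε => by ring
  refine (hbase.mul ((r3.add (k3.const_mul_left a)).add (ksq.const_mul_left b))).congr' ?_
    (Eventually.of_forall fun ε => by ring)
  filter_upwards [hfix] with ε hε
  linear_combination -hε

theorem sqrtCot_I_mul {γ : ℝ} (hγ : 0 < γ) :
    sqrtCot (Complex.I * γ) = (√(2 * γ) / 2 : ℂ) * (1 + Complex.I) *
      ((Real.sin √(2 * γ) : ℂ) - Real.sinh √(2 * γ) * Complex.I)
        / ((Real.cosh √(2 * γ) - Real.cos √(2 * γ) : ℝ) : ℂ) := by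
  have ht : 0 < √(2 * γ) := by positivity
  have hsq : ((√(2 * γ) : ℝ) : ℂ) ^ 2 = 2 * γ := by
    rw [← Complex.ofReal_pow, Real.sq_sqrt (by positivity)]; push_cast; ring
  set t := √(2 * γ)
  have h1 := cos_div_sin (t / 2) (t / 2) (by positivity)
  rw [mul_div_cancel₀ t two_ne_zero] at h1
  rw [sqrtCot_sq (w := ((t / 2 : ℝ) : ℂ) + ((t / 2 : ℝ) : ℂ) * Complex.I), mul_div_assoc, h1]
  · push_cast; ring
  · push_cast
    linear_combination (t : ℂ) ^ 2 / 4 * Complex.I_sq + Complex.I / 2 * hsq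

theorem sqrtCot_neg_I_mul {γ : ℝ} (hγ : 0 < γ) :
    sqrtCot (-(Complex.I * γ)) = (√(2 * γ) / 2 : ℂ) * (1 - Complex.I) *
      ((Real.sin √(2 * γ) : ℂ) + Real.sinh √(2 * γ) * Complex.I)
        / ((Real.cosh √(2 * γ) - Real.cos √(2 * γ) : ℝ) : ℂ) := by
  have ht : 0 < √(2 * γ) := by positivity
  have hsq : ((√(2 * γ) : ℝ) : ℂ) ^ 2 = 2 * γ := by
    rw [← Complex.ofReal_pow, Real.sq_sqrt (by positivity)]; push_cast; ring
  set t := √(2 * γ)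
  have h1 := cos_div_sin (t / 2) (-(t / 2)) (by simpa using ht.ne')
  rw [mul_neg, mul_div_cancel₀ t two_ne_zero, Real.cosh_neg, Real.sinh_neg] at h1
  rw [sqrtCot_sq (w := ((t / 2 : ℝ) : ℂ) + ((-(t / 2) : ℝ) : ℂ) * Complex.I), mul_div_assoc, h1]
  · push_cast; ring
  · push_cast
    linear_combination (t : ℂ) ^ 2 / 4 * Complex.I_sq - Complex.I / 2 * hsq

/-- The first Taylor coefficient of `phaseShift γ` at the origin. -/
noncomputable def phaseCoeffOne (γ : ℝ) : ℂ :=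
  Complex.I / (2 * γ) * (sqrtCot (-(Complex.I * γ)) - sqrtCot (Complex.I * γ))

/-- The second Taylor coefficient of `phaseShift γ` at the origin. -/
noncomputable def phaseCoeffTwo (γ : ℝ) : ℂ :=
  -(Complex.I / (2 * γ ^ 2) * (sqrtCot (Complex.I * γ) ^ 2 + sqrtCot (-(Complex.I * γ)) ^ 2))

theorem phaseCoeffOne_eq {γ : ℝ} (hγ : 0 < γ) :
    phaseCoeffOne γ = ((-(√2 * (Real.sinh √(2 * γ) - Real.sin √(2 * γ))
      / (2 * √γ * (Real.cosh √(2 * γ) - Real.cos √(2 * γ)))) : ℝ) : ℂ) := by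
  have hD := (cosh_sub_cos_pos (t := √(2 * γ)) (by positivity)).ne'
  have hg : √γ ≠ 0 := by positivity
  have hgg : ((√γ : ℝ) : ℂ) ^ 2 = γ := by rw [← Complex.ofReal_pow, Real.sq_sqrt hγ.le]
  have hs : √(2 * γ) = √2 * √γ := Real.sqrt_mul zero_le_two γ
  rw [phaseCoeffOne, sqrtCot_I_mul hγ, sqrtCot_neg_I_mul hγ]
  set S := Real.sinh √(2 * γ)
  set T := Real.sin √(2 * γ)
  set D := Real.cosh √(2 * γ) - Real.cos √(2 * γ)
  rw [hs, ← hgg]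
  have hD' : (D : ℂ) ≠ 0 := by exact_mod_cast hD
  have hg' : ((√γ : ℝ) : ℂ) ≠ 0 := by exact_mod_cast hg
  push_cast
  field_simp
  ring_nf
  rw [Complex.I_sq]
  ring

theorem phaseCoeffTwo_eq {γ : ℝ} (hγ : 0 < γ) :
    phaseCoeffTwo γ = -(2 * Complex.I * ((Real.sinh √(2 * γ) * Real.sin √(2 * γ)
      / (γ * (Real.cosh √(2 * γ) - Real.cos √(2 * γ)) ^ 2) : ℝ) : ℂ)) := by
  have hD := (cosh_sub_cos_pos (t := √(2 * γ)) (by positivity)).ne'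
  have hsq : ((√(2 * γ) : ℝ) : ℂ) ^ 2 = 2 * γ := by
    rw [← Complex.ofReal_pow, Real.sq_sqrt (by positivity)]; push_cast; ring
  rw [phaseCoeffTwo, sqrtCot_I_mul hγ, sqrtCot_neg_I_mul hγ]
  set S := Real.sinh √(2 * γ)
  set T := Real.sin √(2 * γ)
  set D := Real.cosh √(2 * γ) - Real.cos √(2 * γ)
  have hD' : (D : ℂ) ≠ 0 := by exact_mod_cast hD
  have hγ' : (γ : ℂ) ≠ 0 := by exact_mod_cast hγ.ne'
  have e1 : ((1 + Complex.I) * ((T : ℂ) - S * Complex.I)) ^ 2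
      + ((1 - Complex.I) * ((T : ℂ) + S * Complex.I)) ^ 2 = 8 * S * T := by
    linear_combination (2 * T ^ 2 + 2 * S ^ 2 * (Complex.I ^ 2) - 8 * S * T) * Complex.I_sq
  have e2 : ((√(2 * γ) / 2 : ℂ) * (1 + Complex.I) * ((T : ℂ) - S * Complex.I) / (D : ℂ)) ^ 2
      + ((√(2 * γ) / 2 : ℂ) * (1 - Complex.I) * ((T : ℂ) + S * Complex.I) / (D : ℂ)) ^ 2
      = 4 * γ * S * T / D ^ 2 := by
    calc _ = (√(2 * γ) : ℂ) ^ 2 / 4 / D ^ 2 * (((1 + Complex.I) * ((T : ℂ) - S * Complex.I)) ^ 2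
          + ((1 - Complex.I) * ((T : ℂ) + S * Complex.I)) ^ 2) := by ring
      _ = _ := by rw [e1, hsq]; ring
  rw [e2]
  push_cast
  field_simp
  ring

theorem coeffTwo_eq {γ : ℝ} (hγ : 0 < γ) (n : ℤ) :
    (coeffTwo γ n : ℂ) = (coeffOne n : ℂ) * phaseCoeffOne γ := by
  rw [phaseCoeffOne_eq hγ, ← Complex.ofReal_mul, coeffTwo, coeffOne]
  congr 1
  generalize Real.cosh √(2 * γ) - Real.cos √(2 * γ) = D
  ring

theorem coeffThree_eq {γ : ℝ} (hγ : 0 < γ) (n : ℤ) :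
    coeffThree γ n = (coeffOne n : ℂ) * phaseCoeffOne γ ^ 2
      + phaseCoeffTwo γ * (coeffOne n : ℂ) ^ 2 := by
  have hD := (cosh_sub_cos_pos (t := √(2 * γ)) (by positivity)).ne'
  have hgg : ((√γ : ℝ) : ℂ) ^ 2 = γ := by rw [← Complex.ofReal_pow, Real.sq_sqrt hγ.le]
  have h2 : ((√2 : ℝ) : ℂ) ^ 2 = 2 := by rw [← Complex.ofReal_pow, Real.sq_sqrt zero_le_two]; simp
  have hg' : ((√γ : ℝ) : ℂ) ≠ 0 := by
    have : √γ ≠ 0 := by positivity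
    exact_mod_cast this
  rw [phaseCoeffOne_eq hγ, phaseCoeffTwo_eq hγ, coeffThree, coeffOne]
  set S := Real.sinh √(2 * γ)
  set T := Real.sin √(2 * γ)
  set D := Real.cosh √(2 * γ) - Real.cos √(2 * γ)
  have hD' : (D : ℂ) ≠ 0 := by exact_mod_cast hD
  push_cast
  rw [← hgg]
  field_simp
  rw [h2]
  ring

theorem coeffThree_im (γ : ℝ) (n : ℤ) : (coeffThree γ n).im =
    -(2 * (Real.pi ^ 2 * n ^ 2 * Real.sinh √(2 * γ))
      / (4 * γ * (Real.cosh √(2 * γ) - Real.cos √(2 * γ)) ^ 2)) * Real.sin √(2 * γ) := by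
  rw [coeffThree, Complex.neg_im, Complex.div_ofReal_im, Complex.sub_im, Complex.ofReal_im,
    Complex.im_mul_ofReal]
  have : (2 * Complex.I).im = 2 := by simp
  rw [this]
  generalize Real.cosh √(2 * γ) - Real.cos √(2 * γ) = D
  ring

/-- As a and b are real, Im k = Im c · ℓ⁻³ + O(ℓ⁻⁴); an error strictly below the main term fixes the
sign of Im k. -/
theorem eventually_abs_im_sub_lt {k : ℝ → ℂ} {a b : ℝ} {c : ℂ}
    (h : (fun ℓ : ℝ => k ℓ - ((a : ℂ) * (ℓ : ℂ)⁻¹ + (b : ℂ) * (ℓ : ℂ)⁻¹ ^ 2 + c * (ℓ : ℂ)⁻¹ ^ 3))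
      =O[atTop] (fun ℓ : ℝ => ℓ⁻¹ ^ 4)) (hc : c.im ≠ 0) :
    ∀ᶠ ℓ : ℝ in atTop, 0 < ℓ⁻¹ ^ 3 ∧ |(k ℓ).im - c.im * ℓ⁻¹ ^ 3| < |c.im| * ℓ⁻¹ ^ 3 := by
  obtain ⟨C, hC⟩ := h.bound
  have hlim : Tendsto (fun ℓ : ℝ => C * ℓ⁻¹) atTop (𝓝 0) := by
    simpa using tendsto_inv_atTop_zero.const_mul C
  filter_upwards [hC, hlim.eventually_lt_const (abs_pos.2 hc), eventually_gt_atTop 0] with ℓ h1 h2 h3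
  have hp : 0 < ℓ⁻¹ ^ 3 := by positivity
  refine ⟨hp, ?_⟩
  have e : (k ℓ - ((a : ℂ) * (ℓ : ℂ)⁻¹ + (b : ℂ) * (ℓ : ℂ)⁻¹ ^ 2 + c * (ℓ : ℂ)⁻¹ ^ 3)).im
      = (k ℓ).im - c.im * ℓ⁻¹ ^ 3 := by
    simp only [← Complex.ofReal_inv, ← Complex.ofReal_pow, ← Complex.ofReal_mul, Complex.sub_im,
      Complex.add_im, Complex.ofReal_im, Complex.im_mul_ofReal]
    ring
  rw [← e]
  refine (Complex.abs_im_le_norm _).trans_lt (h1.trans_lt ?_)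
  rw [Real.norm_of_nonneg (by positivity)]
  calc C * ℓ⁻¹ ^ 4 = C * ℓ⁻¹ * ℓ⁻¹ ^ 3 := by ring
    _ < _ := by gcongr

end zero_expansion

/-! ### Existence, uniqueness and location of the zero -/

theorem lemma3p4 (γ : ℝ) (hγ : 0 < γ) (n : ℤ) :
    ∃ k : ℝ → ℂ,
      -- for every admissible `ℓ`, `k ℓ` is the only zero in the disc, and it is simple
      (∀ ℓ : ℝ, Admissible γ n ℓ →
        k ℓ ∈ zeroDisc n ℓ ∧ waveF (k ℓ) ℓ γ = 0 ∧
        analyticOrderAt (fun z : ℂ => waveF z ℓ γ) (k ℓ) = 1 ∧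
        ∀ z ∈ zeroDisc n ℓ, waveF z ℓ γ = 0 → z = k ℓ) ∧
      -- the zero is holomorphic in `ε = ℓ⁻¹`, up to and including `ε = 0`
      (∃ (U : Set ℂ) (κ : ℂ → ℂ), IsOpen U ∧ (0 : ℂ) ∈ U ∧
        (∀ ε : ℝ, 0 ≤ ε → (Real.pi * |(n : ℝ)| / 2 + Real.pi / 4) * ε ≤ Theta γ → (ε : ℂ) ∈ U) ∧
        DifferentiableOn ℂ κ U ∧
        ∀ ℓ : ℝ, Admissible γ n ℓ → k ℓ = κ ((ℓ⁻¹ : ℝ) : ℂ)) ∧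
      -- the leading terms of the Taylor series
      (fun ℓ : ℝ => k ℓ - ((coeffOne n : ℂ) * (ℓ : ℂ)⁻¹ + (coeffTwo γ n : ℂ) * (ℓ : ℂ)⁻¹ ^ 2
          + coeffThree γ n * (ℓ : ℂ)⁻¹ ^ 3))
        =O[Filter.atTop] (fun ℓ : ℝ => ℓ⁻¹ ^ 4) ∧
      -- the half-plane which contains the zero for large `ℓ`
      (n ≠ 0 → Real.sin √(2 * γ) < 0 → ∀ᶠ ℓ : ℝ in Filter.atTop, 0 < (k ℓ).im) ∧
      (n ≠ 0 → 0 < Real.sin √(2 * γ) → ∀ᶠ ℓ : ℝ in Filter.atTop, (k ℓ).im < 0) := by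
  have hT := Theta_pos hγ
  have hpi := Real.pi_gt_three
  set T := Theta γ with hTdef
  set A := Real.pi * |(n : ℝ)| / 2 + Real.pi / 4 with hA
  have hA34 : 3 / 4 < A := by
    have : 0 ≤ Real.pi * |(n : ℝ)| / 2 := by positivity
    linarith
  have hN : ‖(coeffOne n : ℂ)‖ = A - Real.pi / 4 := by
    rw [Complex.norm_real, coeffOne, Real.norm_eq_abs, abs_div, abs_mul, abs_of_pos Real.pi_pos,
      abs_two, hA]
    ring
  have hφ : ∀ z : ℂ, ‖z‖ ≤ 9 / 8 * T → ‖(coeffOne n : ℂ) + phaseShift γ z‖ ≤ A := by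
    intro z hz
    have h1 := norm_phaseShift_le (k := z) hγ (by linarith)
    have h2 := norm_add_le (coeffOne n : ℂ) (phaseShift γ z)
    linarith
  have hmemU : ∀ {ε : ℂ}, ε ∈ Metric.ball (0 : ℂ) (9 / 8 * T / A) ↔ ‖ε‖ * A < 9 / 8 * T := by
    intro ε
    rw [mem_ball_zero_iff, lt_div_iff₀ (by linarith)]
  -- The factor 9/8 > 1 lets the open ball contain the closed segment Aε ≤ Θ. The rate is |ε|/(2Θ) <
  -- 9/(16A) < 3/4, because A > 3/4.
  obtain ⟨κ, hκd, hκ⟩ := exists_differentiableOn_fixedPoint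
    (φ := fun z => (coeffOne n : ℂ) + phaseShift γ z) (r := 9 / 8 * T) (q := 3 / 4)
    (L := 1 / (2 * T)) (U := Metric.ball 0 (9 / 8 * T / A)) Metric.isOpen_ball (by positivity)
    (by norm_num) (by norm_num)
    (fun z hz => (differentiableAt_phaseShift hγ (by linarith)).const_add _)
    (fun x y hx hy => by simpa using norm_phaseShift_sub_le hγ hx hy)
    (fun ε hε z hz => by
      rw [norm_mul]
      exact (mul_le_mul_of_nonneg_left (hφ z hz) (norm_nonneg ε)).trans (hmemU.1 hε).le)
    (fun ε hε => by
      have h1 := hmemU.1 hε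
      have h2 := norm_nonneg ε
      rw [mul_one_div, div_le_iff₀ (by positivity)]
      nlinarith)
  have hreal : ∀ ε : ℝ, 0 ≤ ε → A * ε ≤ T → (ε : ℂ) ∈ Metric.ball (0 : ℂ) (9 / 8 * T / A) := by
    intro ε h0 h1
    rw [hmemU, Complex.norm_real, Real.norm_of_nonneg h0]
    linarith
  have h0U : (0 : ℂ) ∈ Metric.ball (0 : ℂ) (9 / 8 * T / A) :=
    Metric.mem_ball_self (div_pos (by positivity) (by linarith))
  have hadm : ∀ ℓ : ℝ, Admissible γ n ℓ → 0 < ℓ ∧ A ≤ T * ℓ ∧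
      ((ℓ⁻¹ : ℝ) : ℂ) ∈ Metric.ball (0 : ℂ) (9 / 8 * T / A) := by
    intro ℓ hℓ
    have h1 : A ≤ T * ℓ := hℓ
    have h2 : 0 < ℓ := pos_of_mul_pos_right (by linarith : 0 < T * ℓ) hT.le
    exact ⟨h2, h1, hreal _ (by positivity) (by rwa [← div_eq_mul_inv, div_le_iff₀ h2])⟩
  have hasymp : (fun ℓ : ℝ => κ ((ℓ⁻¹ : ℝ) : ℂ) - ((coeffOne n : ℂ) * (ℓ : ℂ)⁻¹
      + (coeffTwo γ n : ℂ) * (ℓ : ℂ)⁻¹ ^ 2 + coeffThree γ n * (ℓ : ℂ)⁻¹ ^ 3))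
        =O[Filter.atTop] (fun ℓ : ℝ => ℓ⁻¹ ^ 4) := by
    have hd0 : DifferentiableAt ℂ κ 0 := hκd.differentiableAt (Metric.isOpen_ball.mem_nhds h0U)
    have hκ0 : κ 0 = 0 := by simpa using (hκ 0 h0U).2
    have hO : κ =O[nhds 0] (fun ε : ℂ => ε) := by simpa [hκ0] using hd0.hasFDerivAt.isBigO_sub
    have hexp := isBigO_fixedPoint (N := (coeffOne n : ℂ)) (isBigO_phaseShift hγ.ne') hO
      (by filter_upwards [Metric.isOpen_ball.mem_nhds h0U] with ε hε using (hκ ε hε).2)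
    have htend : Filter.Tendsto (fun ℓ : ℝ => ((ℓ⁻¹ : ℝ) : ℂ)) Filter.atTop (nhds 0) := by
      rw [← Complex.ofReal_zero]
      exact (Complex.continuous_ofReal.tendsto 0).comp tendsto_inv_atTop_zero
    rw [coeffTwo_eq hγ, coeffThree_eq hγ]
    refine ((hexp.comp_tendsto htend).congr_left fun ℓ => ?_).trans
      (Asymptotics.IsBigO.of_bound 1 (Filter.Eventually.of_forall fun ℓ => ?_))
    · simp [phaseCoeffOne, phaseCoeffTwo]
    · simp
  have him := coeffThree_im γ n
  have hfactor : n ≠ 0 → 0 < 2 * (Real.pi ^ 2 * (n : ℝ) ^ 2 * Real.sinh √(2 * γ))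
      / (4 * γ * (Real.cosh √(2 * γ) - Real.cos √(2 * γ)) ^ 2) := by
    intro hn
    have h1 : (n : ℝ) ≠ 0 := by exact_mod_cast hn
    have h2 : 0 < √(2 * γ) := by positivity
    have h3 : 0 < Real.sinh √(2 * γ) := Real.sinh_pos_iff.2 h2
    have h4 := cosh_sub_cos_pos h2.ne'
    positivity
  refine ⟨fun ℓ => κ ((ℓ⁻¹ : ℝ) : ℂ), fun ℓ hℓ => ?_, ⟨_, κ, Metric.isOpen_ball, h0U, hreal, hκd,
    fun _ _ => rfl⟩, hasymp, fun hn hsin => ?_, fun hn hsin => ?_⟩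
  · obtain ⟨hℓ0, hAℓ, hεU⟩ := hadm ℓ hℓ
    obtain ⟨hkr, hfix⟩ := hκ _ hεU
    set w := κ ((ℓ⁻¹ : ℝ) : ℂ) with hw
    have hℓc : (ℓ : ℂ) ≠ 0 := by exact_mod_cast hℓ0.ne'
    have hcenter : ((Real.pi * n / (2 * ℓ) : ℝ) : ℂ) = coeffOne n / ℓ := by
      rw [coeffOne]; push_cast; ring
    have hdisc : ∀ z : ℂ, z ∈ zeroDisc n ℓ ↔ ‖z * ℓ - coeffOne n‖ < Real.pi / 4 := by
      intro z
      have e : z * ℓ - coeffOne n = (z - coeffOne n / ℓ) * ℓ := by field_simp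
      rw [zeroDisc, Metric.mem_ball, dist_eq_norm, hcenter, e, norm_mul, Complex.norm_real,
        Real.norm_of_nonneg hℓ0.le, ← lt_div_iff₀ hℓ0, div_div]
    have hfix' : w * ℓ = coeffOne n + phaseShift γ w := by
      rw [hfix, ← hfix]
      nth_rewrite 1 [hfix]
      push_cast
      field_simp
    have hzero : waveF w ℓ γ = 0 := (waveF_eq_zero_iff hγ (by linarith) ℓ).2
      ⟨n, by rw [hfix', coeffOne]; push_cast; ring⟩
    refine ⟨?_, hzero, ?_, fun z hz hz0 => ?_⟩
    · rw [hdisc, hfix', add_sub_cancel_left]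
      have := norm_phaseShift_le (k := w) hγ (by linarith)
      linarith
    · refine analyticOrderAt_waveF hγ hkr ?_ hzero
      rw [div_lt_iff₀ (by positivity)]
      linarith
    · have hz' := (hdisc z).1 hz
      -- |z|ℓ < π/4 + π|n|/2 = A ≤ Θℓ.
      have hzT : ‖z‖ ≤ T := by
        have h1 := norm_add_le (z * ℓ - coeffOne n) (coeffOne n : ℂ)
        rw [sub_add_cancel, norm_mul, Complex.norm_real, Real.norm_of_nonneg hℓ0.le, hN] at h1
        exact le_of_mul_le_mul_right (by linarith) hℓ0
      obtain ⟨m, hm⟩ := (waveF_eq_zero_iff hγ (by linarith) ℓ).1 hz0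
      -- (π/2)|m - n| < π/4 + 3/8 < π/2.
      have hmn : m = n := by
        have h1 := norm_phaseShift_le (k := z) hγ (by linarith)
        have h2 := norm_sub_le (z * ℓ - coeffOne n) (phaseShift γ z)
        have e : z * ℓ - coeffOne n - phaseShift γ z
            = ((Real.pi / 2 * ((m - n : ℤ) : ℝ) : ℝ) : ℂ) := by
          rw [hm, coeffOne]; push_cast; ring
        rw [e, Complex.norm_real, Real.norm_eq_abs, abs_mul, abs_of_pos (by positivity)] at h2
        have h3 : |((m - n : ℤ) : ℝ)| < 1 := by
          by_contra hcon
          push Not at hcon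
          nlinarith
        rw [← Int.cast_abs] at h3
        have h4 : |m - n| < 1 := by exact_mod_cast h3
        exact sub_eq_zero.1 (Int.abs_lt_one_iff.1 h4)
      -- Two distinct solutions would force ℓ ≤ 1/(2Θ), against Θℓ ≥ A > 3/4.
      have hdiff : (z - w) * ℓ = phaseShift γ z - phaseShift γ w := by
        rw [sub_mul, hm, hfix', hmn, coeffOne]; push_cast; ring
      have hlip := norm_phaseShift_sub_le hγ (x := z) (y := w) (by linarith) hkr
      rw [← hdiff, norm_mul, Complex.norm_real, Real.norm_of_nonneg hℓ0.le,
        mul_comm (1 / (2 * Theta γ)), mul_one_div, le_div_iff₀ (by positivity)] at hlip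
      by_contra hne
      have hpos := norm_pos_iff.2 (sub_ne_zero.2 hne)
      nlinarith
  · have hc : 0 < (coeffThree γ n).im := by
      rw [him, neg_mul]
      exact neg_pos.2 (mul_neg_of_pos_of_neg (hfactor hn) hsin)
    filter_upwards [eventually_abs_im_sub_lt hasymp hc.ne'] with ℓ hℓ
    rw [abs_of_pos hc] at hℓ
    linarith [(abs_lt.1 hℓ.2).1]
  · have hc : (coeffThree γ n).im < 0 := by
      rw [him, neg_mul]
      exact neg_lt_zero.2 (mul_pos (hfactor hn) hsin)
    filter_upwards [eventually_abs_im_sub_lt hasymp hc.ne] with ℓ hℓ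
    rw [abs_of_neg hc] at hℓ
    linarith [(abs_lt.1 hℓ.2).2]
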